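/- Let $\mathfrak{A}$ be an associative unital ring that is $2$-torsion free (i.e. $2a=0$ implies $a=0$ for $a\in\mathfrak{A}$), let $r\geq 2$ and $n\geq 2$ be integers, and let $T=T_r(\mathfrak{A})$ be the ring of upper triangular $r\times r$ matrices over $\mathfrak{A}$. For $s,t\in T$ put $s\circ t=st+ts$, and define $q_1(t_1)=t_1$ and $q_k(t_1,\dots,t_k)=q_{k-1}(t_1,\dots,t_{k-1})\circ t_k$ for $k\ge 2$. Let $\Delta:T\to T$ be a multiplicative generalized Jordan $n$-derivation, i.e. a map (not assumed additive) for which there is a map $d:T\to T$ (not assumed additive) such that $$d(q_n(t_1,\dots,t_n))=\sum_{i=1}^n q_n(t_1,\dots,t_{i-1},d(t_i),t_{i+1},\dots,t_n)$$ and $$\Delta(q_n(t_1,\dots,t_n))=q_n(\Delta(t_1),t_2,\dots,t_n)+\sum_{i=2}^n q_n(t_1,\dots,t_{i-1},d(t_i),t_{i+1},\dots,t_n)$$ for all $t_1,\dots,t_n\in T$. Then there exist an element $\mu$ of the center $\mathcal{Z}(\mathfrak{A})$ of $\mathfrak{A}$ and a derivation $\delta:T\to T$ (an additive map with $\delta(st)=\delta(s)t+s\delta(t)$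 for all $s,t\in T$) such that $$\Delta(t)=\mu t+\delta(t)\qquad\text{for all } t\in T.$$ -/

import Mathlib

/-- The Jordan product `a ∘ b = a b + b a`. -/
def jordanProd {R : Type*} [Ring R] (a b : R) : R :=
  a * b + b * a

/-- The iterated Jordan product `q_n(t_1, …, t_n)`, left-nested: `q_1(t_1) = t_1` and
`q_n(t_1, …, t_n) = q_{n-1}(t_1, …, t_{n-1}) ∘ t_n` for `n ≥ 2`.
The value for `n = 0` is a placeholder and plays no role. -/
def jordanQ {R : Type*} [Ring R] : (n : ℕ) → (Fin n → R) → R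
  | 0, _ => 0
  | 1, t => t 0
  | n + 2, t => jordanProd (jordanQ (n + 1) (fun i => t i.castSucc)) (t (Fin.last (n + 1)))

/-- Multiplicative Jordan `n`-derivation: a (not necessarily additive) map `δ` such that
`δ(q_n(t_1, …, t_n)) = ∑ i, q_n(t_1, …, δ(t_i), …, t_n)`. -/
def IsMulJordanDerivation {R : Type*} [Ring R] (n : ℕ) (δ : R → R) : Prop :=
  ∀ t : Fin n → R,
    δ (jordanQ n t) = ∑ i, jordanQ n (Function.update t i (δ (t i)))

/-- Multiplicative generalized Jordan `n`-derivation: a (not necessarily additive) map `Δ` for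
which there is a multiplicative Jordan `n`-derivation `δ` such that `Δ(q_n(t_1, …, t_n))` equals
`q_n(Δ(t_1), t_2, …, t_n)` plus the sum of `q_n(t_1, …, δ(t_i), …, t_n)` over the remaining
indices `i`. (The first index is `0 : Fin n`.) -/
def IsMulGenJordanDerivation {R : Type*} [Ring R] (n : ℕ) [NeZero n] (Δ : R → R) : Prop :=
  ∃ δ : R → R, IsMulJordanDerivation n δ ∧
    ∀ t : Fin n → R,
      Δ (jordanQ n t) =
        jordanQ n (Function.update t 0 (Δ (t 0))) +
          ∑ i ∈ Finset.univ.erase (0 : Fin n), jordanQ n (Function.update t i (δ (t i)))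

/-- Derivation of a (possibly noncommutative) ring: an additive map satisfying the Leibniz rule. -/
structure IsRingDerivation {R : Type*} [Ring R] (δ : R → R) : Prop where
  map_add : ∀ s t, δ (s + t) = δ s + δ t
  map_mul : ∀ s t, δ (s * t) = δ s * t + s * δ t

/-- The ring `T_r(A)` of upper triangular `r × r` matrices over `A`. -/
def upperTriangularRing (r : ℕ) (A : Type*) [Ring A] : Subring (Matrix (Fin r) (Fin r) A) where
  carrier := {M | M.IsUpperTriangular}
  mul_mem' hM hN := Matrix.BlockTriangular.mul hM hN
  one_mem' := Matrix.blockTriangular_one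
  add_mem' hM hN := Matrix.BlockTriangular.add hM hN
  zero_mem' := Matrix.blockTriangular_zero
  neg_mem' hM := Matrix.BlockTriangular.neg hM

/-! ### Iterated Jordan products as left folds over lists. -/

section JordanFold

variable {R : Type*} [Ring R]

/-! Subtracting the defining identities shows that `θ = Δ - d` lets Jordan products act only on its
first argument, so it suffices to prove that `θ` is multiplication by a central element and that `d`
is a central multiplication plus a derivation.

Both are proved in any 2-torsion free ring with a triangular pair `e`, `f = 1 - e`. Relative to the
Peirce components `x * e`, `e * x * f`, `f * x`, Jordan multiplication by `e` doubles the first,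
fixes the second and kills the third; `f` does the opposite. Folding with copies of `e` and `f` thus
isolates components up to powers of 2. An element that anticommutes with the corner `e R f` and has
one zero diagonal component has both zero, by faithfulness. This replaces additivity, which is not
assumed.

For `θ`, the central element is assembled from `θ e` and `θ f`
(`IsJordanListCentralizer.eq_center_mul`). For `d`, an inner derivation removes the corner parts of
`d e` and `d f`; their remaining sum `c` is central and killed by the number of list entries, so
multiplication by `c` is itself a Jordan derivation and can be subtracted. What is left vanishes at
`e` and `f`, and `isRingDerivation_of_normalized` makes it a derivation. -/

theorem jordanProd_comm (a b : R) : jordanProd a b = jordanProd b a := add_comm _ _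

theorem jordanProd_add_left (a b c : R) :
    jordanProd (a + b) c = jordanProd a c + jordanProd b c := by
  simp only [jordanProd]; noncomm_ring

theorem jordanProd_sub_left (a b c : R) :
    jordanProd (a - b) c = jordanProd a c - jordanProd b c := by
  simp only [jordanProd]; noncomm_ring

theorem jordanProd_sub_right (a b c : R) :
    jordanProd a (b - c) = jordanProd a b - jordanProd a c := by
  simp only [jordanProd]; noncomm_ring

theorem jordanProd_zero_left (a : R) : jordanProd 0 a = 0 := by simp [jordanProd]

theorem jordanProd_zero_right (a : R) : jordanProd a 0 = 0 := by simp [jordanProd]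

/-- The left-nested Jordan product of `x` with the entries of a list. -/
def jordanFold (x : R) (l : List R) : R := l.foldl jordanProd x

@[simp] theorem jordanFold_nil (x : R) : jordanFold x [] = x := rfl

@[simp] theorem jordanFold_cons (x a : R) (l : List R) :
    jordanFold x (a :: l) = jordanFold (jordanProd x a) l := rfl

theorem jordanFold_append (x : R) (l l' : List R) :
    jordanFold x (l ++ l') = jordanFold (jordanFold x l) l' := by
  simp [jordanFold, List.foldl_append]

theorem jordanFold_add (x y : R) (l : List R) :
    jordanFold (x + y) l = jordanFold x l + jordanFold y l := by
  induction l generalizing x y with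
  | nil => rfl
  | cons a l ih => simp [jordanProd_add_left, ih]

theorem jordanFold_sub (x y : R) (l : List R) :
    jordanFold (x - y) l = jordanFold x l - jordanFold y l := by
  induction l generalizing x y with
  | nil => rfl
  | cons a l ih => simp [jordanProd_sub_left, ih]

@[simp] theorem jordanFold_zero (l : List R) : jordanFold (0 : R) l = 0 := by
  induction l with
  | nil => rfl
  | cons a l ih => simp [jordanProd_zero_left, ih]

theorem jordanFold_center_mul {c : R} (hc : ∀ x, c * x = x * c) (x : R) (l : List R) :
    jordanFold (c * x) l = c * jordanFold x l := by
  induction l generalizing x with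
  | nil => rfl
  | cons a l ih =>
    rw [jordanFold_cons, jordanFold_cons, ← ih]
    congr 1
    simp only [jordanProd, mul_add, mul_assoc]
    rw [← mul_assoc a c x, ← hc a, mul_assoc]

/-- The sum of the Jordan products of `x` with the entries of a list where `d` is applied to
one of the entries of the list. -/
def jordanVariation (d : R → R) : R → List R → R
  | _, [] => 0
  | x, a :: l => jordanFold (jordanProd x (d a)) l + jordanVariation d (jordanProd x a) l

theorem jordanVariation_zero (d : R → R) (l : List R) : jordanVariation d 0 l = 0 := by
  induction l with
  | nil => rfl
  | cons a l ih => simp [jordanVariation, jordanProd_zero_left, ih]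

theorem jordanVariation_append (d : R → R) (x : R) (l l' : List R) :
    jordanVariation d x (l ++ l') =
      jordanFold (jordanVariation d x l) l' + jordanVariation d (jordanFold x l) l' := by
  induction l generalizing x with
  | nil => simp [jordanVariation]
  | cons a l ih =>
    simp [jordanVariation, ih, jordanFold_add, jordanFold_append, add_assoc]

theorem jordanVariation_sub (d g : R → R) (x : R) (l : List R) :
    jordanVariation (fun y => d y - g y) x l = jordanVariation d x l - jordanVariation g x l := by
  induction l generalizing x with
  | nil => simp [jordanVariation]
  | cons a l ih =>
    simp only [jordanVariation, ih, jordanFold_sub, jordanProd_sub_right]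
    abel

theorem jordanVariation_eq_zero {d : R → R} {l : List R} (hl : ∀ a ∈ l, d a = 0) (x : R) :
    jordanVariation d x l = 0 := by
  induction l generalizing x with
  | nil => rfl
  | cons a l ih =>
    simp only [List.mem_cons, forall_eq_or_imp] at hl
    simp [jordanVariation, hl.1, jordanProd_zero_right, ih hl.2]

/-- Jordan derivation property for products of an element with a list of `N` further ones. -/
def IsJordanListDerivation (N : ℕ) (d : R → R) : Prop :=
  ∀ x l, l.length = N → d (jordanFold x l) = jordanFold (d x) l + jordanVariation d x l

/-- Maps commuting with the Jordan products by a list of `N` elements. -/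
def IsJordanListCentralizer (N : ℕ) (θ : R → R) : Prop :=
  ∀ x l, l.length = N → θ (jordanFold x l) = jordanFold (θ x) l

/-- Apply the identity to each half of the list. Doubling ensures at least two entries even when `n
= 2`, enough room for both `e` and `f`. -/
theorem IsJordanListDerivation.two_mul {N : ℕ} {d : R → R} (hd : IsJordanListDerivation N d) :
    IsJordanListDerivation (N + N) d := by
  intro x l hl
  rw [← List.take_append_drop N l]
  have h1 : (l.take N).length = N := by simp [hl]
  have h2 : (l.drop N).length = N := by simp [hl]
  rw [jordanFold_append, jordanFold_append, hd _ _ h2, hd _ _ h1, jordanVariation_append,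
    jordanFold_add, add_assoc]

theorem IsJordanListCentralizer.two_mul {N : ℕ} {d : R → R} (hd : IsJordanListCentralizer N d) :
    IsJordanListCentralizer (N + N) d := by
  intro x l hl
  rw [← List.take_append_drop N l]
  have h1 : (l.take N).length = N := by simp [hl]
  have h2 : (l.drop N).length = N := by simp [hl]
  rw [jordanFold_append, jordanFold_append, hd _ _ h2, hd _ _ h1]

theorem IsJordanListDerivation.sub {N : ℕ} {d g : R → R} (hd : IsJordanListDerivation N d)
    (hg : IsJordanListDerivation N g) : IsJordanListDerivation N (fun x => d x - g x) := by
  intro x l hl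
  simp only [hd x l hl, hg x l hl, jordanFold_sub, jordanVariation_sub]
  abel

theorem isJordanListDerivation_commutator (N : ℕ) (u : R) :
    IsJordanListDerivation N (fun x => x * u - u * x) := by
  rintro x l -
  induction l generalizing x with
  | nil => simp [jordanVariation]
  | cons a l ih =>
    simp only [jordanFold_cons, jordanVariation, ih, ← add_assoc, ← jordanFold_add]
    congr 2
    simp only [jordanProd]; noncomm_ring

/-- Each of the `N` varied entries contributes one more `c` times the product, so the Leibniz
identity holds once `N * c = 0`. -/
theorem isJordanListDerivation_center_mul {N : ℕ} {c : R} (hc : ∀ x, c * x = x * c)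
    (hN : (N : R) * c = 0) : IsJordanListDerivation N (fun x => c * x) := by
  have key : ∀ (l : List R) (x : R),
      jordanVariation (fun x => c * x) x l = (l.length : R) * c * jordanFold x l := by
    intro l
    induction l with
    | nil => intro x; simp [jordanVariation]
    | cons a l ih =>
      intro x
      have : jordanProd x (c * a) = c * jordanProd x a := by
        simp only [jordanProd, mul_add]
        rw [← mul_assoc x, ← hc x, mul_assoc, mul_assoc]
      simp only [jordanVariation, ih, this, jordanFold_center_mul hc, jordanFold_cons,
        List.length_cons]
      push_cast
      noncomm_ring
  intro x l hl
  rw [key, hl, hN, jordanFold_center_mul hc, zero_mul, add_zero]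

theorem jordanQ_eq_jordanFold (n : ℕ) (t : Fin (n + 1) → R) :
    jordanQ (n + 1) t = jordanFold (t 0) (List.ofFn fun i : Fin n => t i.succ) := by
  induction n with
  | zero => simp [jordanQ]
  | succ n ih =>
    rw [jordanQ, ih, List.ofFn_succ', List.concat_eq_append, jordanFold_append]
    rfl

theorem sum_jordanQ_update (d : R → R) (n : ℕ) (t : Fin (n + 1) → R) :
    ∑ i, jordanQ (n + 1) (Function.update t i (d (t i))) =
      jordanFold (d (t 0)) (List.ofFn fun i : Fin n => t i.succ) +
        jordanVariation d (t 0) (List.ofFn fun i : Fin n => t i.succ) := by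
  induction n with
  | zero => simp [jordanQ, jordanVariation]
  | succ n ih =>
    have h1 : ∀ i : Fin (n + 1),
        jordanQ (n + 2) (Function.update t i.castSucc (d (t i.castSucc))) =
          jordanProd (jordanQ (n + 1) (Function.update (fun j => t j.castSucc) i
            (d (t i.castSucc)))) (t (Fin.last (n + 1))) := by
      intro i
      rw [jordanQ]
      congr 2
      · funext j
        by_cases h : j = i
        · subst h; simp
        · rw [Function.update_of_ne h, Function.update_of_ne (by simpa using h)]
      · rw [Function.update_of_ne (Fin.castSucc_lt_last i).ne']
    have h2 : jordanQ (n + 2)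
        (Function.update t (Fin.last (n + 1)) (d (t (Fin.last (n + 1))))) =
        jordanProd (jordanQ (n + 1) fun j => t j.castSucc) (d (t (Fin.last (n + 1)))) := by
      rw [jordanQ, Function.update_self]
      congr 2
      funext j
      rw [Function.update_of_ne (Fin.castSucc_lt_last j).ne]
    have h3 : ∀ (s : Finset (Fin (n + 1))) (g : Fin (n + 1) → R) (b : R),
        ∑ i ∈ s, jordanProd (g i) b = jordanProd (∑ i ∈ s, g i) b := by
      intro s g b
      simp [jordanProd, Finset.sum_add_distrib, Finset.sum_mul, Finset.mul_sum]
    rw [Fin.sum_univ_castSucc, h2]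
    simp only [h1]
    rw [h3, ih fun j => t j.castSucc, jordanQ_eq_jordanFold, List.ofFn_succ' (n := n),
      List.concat_eq_append, jordanFold_append, jordanVariation_append, jordanProd_add_left,
      add_assoc]
    simp [jordanVariation]

theorem List.ofFn_cons_get {α : Type*} (x : α) (l : List α) :
    (List.ofFn fun i : Fin l.length =>
      (Fin.cons x l.get : Fin (l.length + 1) → α) i.succ) = l := by
  simp

theorem IsMulJordanDerivation.isJordanListDerivation {N : ℕ} {d : R → R}
    (hd : IsMulJordanDerivation (N + 1) d) : IsJordanListDerivation N d := by
  rintro x l rfl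
  have h := hd (Fin.cons x l.get)
  rwa [sum_jordanQ_update, jordanQ_eq_jordanFold, List.ofFn_cons_get, Fin.cons_zero] at h

/-- The terms with `d` at positions other than the first are the same in both identities and cancel.
-/
theorem isJordanListCentralizer_sub {N : ℕ} {Δ d : R → R}
    (hd : IsMulJordanDerivation (N + 1) d)
    (hΔ : ∀ t : Fin (N + 1) → R, Δ (jordanQ (N + 1) t) =
      jordanQ (N + 1) (Function.update t 0 (Δ (t 0))) +
        ∑ i ∈ Finset.univ.erase (0 : Fin (N + 1)),
          jordanQ (N + 1) (Function.update t i (d (t i)))) :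
    IsJordanListCentralizer N (fun x => Δ x - d x) := by
  rintro x l rfl
  have h1 := hd (Fin.cons x l.get)
  have h2 := hΔ (Fin.cons x l.get)
  rw [← Finset.add_sum_erase _ _ (Finset.mem_univ 0)] at h1
  have h3 : ∀ y : R, jordanQ (l.length + 1)
      (Function.update (Fin.cons x l.get : Fin (l.length + 1) → R) 0 y) = jordanFold y l := by
    intro y
    rw [Fin.update_cons_zero, jordanQ_eq_jordanFold, List.ofFn_cons_get, Fin.cons_zero]
  rw [h3, jordanQ_eq_jordanFold, List.ofFn_cons_get, Fin.cons_zero] at h1 h2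
  simp only [h1, h2, jordanFold_sub]
  abel

end JordanFold

/-! ### Triangular rings and their Peirce components. -/

/-- Complementary idempotents `e`, `f` of a ring `R` exhibiting it as a triangular ring: the corner
`f R e` vanishes and `e R f` is faithful as a left `e R e`-module and as a right `f R f`-module. -/
structure IsTriangularPair {R : Type*} [Ring R] (e f : R) : Prop where
  idem : e * e = e
  add_eq_one : e + f = 1
  corner : ∀ x, e * (x * e) = x * e
  faithful_left : ∀ a, (∀ x, a * (e * x * f) = 0) → a * e = 0
  faithful_right : ∀ b, (∀ x, e * x * f * b = 0) → f * b = 0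

/-- Membership in the corner `e R f`. -/
structure InCorner {R : Type*} [Ring R] (e f m : R) : Prop where
  left : e * m = m
  right : m * f = m

namespace IsTriangularPair

variable {R : Type*} [Ring R] {e f : R}

theorem f_eq (h : IsTriangularPair e f) : f = 1 - e := eq_sub_of_add_eq' h.add_eq_one

theorem e_mul_f (h : IsTriangularPair e f) : e * f = 0 := by
  rw [h.f_eq, mul_sub, h.idem, mul_one, sub_self]

theorem f_mul_e (h : IsTriangularPair e f) : f * e = 0 := by
  rw [h.f_eq, sub_mul, h.idem, one_mul, sub_self]

theorem idem_f (h : IsTriangularPair e f) : f * f = f := by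
  nth_rewrite 1 [h.f_eq]
  rw [sub_mul, h.e_mul_f, one_mul, sub_zero]

theorem f_mul_mul_e (h : IsTriangularPair e f) (x : R) : f * (x * e) = 0 := by
  rw [← h.corner, ← mul_assoc, h.f_mul_e, zero_mul]

theorem f_mul_mul_f (h : IsTriangularPair e f) (x : R) : f * (x * f) = f * x := by
  have : f * x = f * (x * (e + f)) := by rw [h.add_eq_one, mul_one]
  rw [this, mul_add, mul_add, h.f_mul_mul_e, zero_add]

theorem eq_components (h : IsTriangularPair e f) (x : R) : x = x * e + e * x * f + f * x := by
  have h1 : x = (e + f) * x * (e + f) := by rw [h.add_eq_one, mul_one, one_mul]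
  nth_rewrite 1 [h1]
  simp only [add_mul, mul_add, mul_assoc, h.corner, h.f_mul_mul_e, h.f_mul_mul_f]
  abel

theorem ext_components (h : IsTriangularPair e f) {x y : R} (h1 : x * e = y * e)
    (h2 : e * x * f = e * y * f) (h3 : f * x = f * y) : x = y := by
  rw [h.eq_components x, h.eq_components y, h1, h2, h3]

theorem eq_zero_of_components (h : IsTriangularPair e f) {x : R} (h1 : x * e = 0)
    (h2 : e * x * f = 0) (h3 : f * x = 0) : x = 0 := by
  rw [h.eq_components x, h1, h2, h3, add_zero, add_zero]

theorem inCorner (h : IsTriangularPair e f) (x : R) : InCorner e f (e * x * f) :=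
  ⟨by rw [← mul_assoc, ← mul_assoc, h.idem], by rw [mul_assoc, h.idem_f]⟩

end IsTriangularPair

namespace InCorner

variable {R : Type*} [Ring R] {e f m : R}

theorem eq_mul_mul (hm : InCorner e f m) : e * m * f = m := by rw [hm.left, hm.right]

theorem mul_e (h : IsTriangularPair e f) (hm : InCorner e f m) : m * e = 0 := by
  rw [← hm.right, mul_assoc, h.f_mul_e, mul_zero]

theorem f_mul (h : IsTriangularPair e f) (hm : InCorner e f m) : f * m = 0 := by
  rw [← hm.left, ← mul_assoc, h.f_mul_e, zero_mul]

theorem mul_left (h : IsTriangularPair e f) (hm : InCorner e f m) (x : R) :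
    InCorner e f (x * m) := by
  refine ⟨?_, by rw [mul_assoc, hm.right]⟩
  rw [← hm.left, ← mul_assoc x, ← mul_assoc, h.corner]

theorem mul_right (h : IsTriangularPair e f) (hm : InCorner e f m) (x : R) :
    InCorner e f (m * x) := by
  refine ⟨by rw [← mul_assoc, hm.left], ?_⟩
  rw [← hm.right, mul_assoc, mul_assoc, mul_assoc, h.f_mul_mul_f]

theorem add {m' : R} (hm : InCorner e f m) (hm' : InCorner e f m') : InCorner e f (m + m') :=
  ⟨by rw [mul_add, hm.left, hm'.left], by rw [add_mul, hm.right, hm'.right]⟩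

theorem mul_eq (hm : InCorner e f m) (x : R) : x * e * m = x * m := by
  rw [mul_assoc, hm.left]

theorem mul_eq' (hm : InCorner e f m) (x : R) : m * (f * x) = m * x := by
  rw [← mul_assoc, hm.right]

end InCorner

namespace IsTriangularPair

variable {R : Type*} [Ring R] {e f : R}

theorem mul_e_eq_zero (h : IsTriangularPair e f) {a : R}
    (ha : ∀ m, InCorner e f m → a * m = 0) : a * e = 0 :=
  h.faithful_left a fun x => ha _ (h.inCorner x)

theorem f_mul_eq_zero (h : IsTriangularPair e f) {b : R}
    (hb : ∀ m, InCorner e f m → m * b = 0) : f * b = 0 :=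
  h.faithful_right b fun x => hb _ (h.inCorner x)

/-- An element without off-diagonal part which commutes with the corner is central. -/
theorem central_of_commute_corner (h : IsTriangularPair e f) {c : R} (h0 : e * c * f = 0)
    (hc : ∀ m, InCorner e f m → c * m = m * c) (x : R) : c * x = x * c := by
  have hce : e * c = c * e := by
    have : e * c * (e + f) = e * c := by rw [h.add_eq_one, mul_one]
    rw [← this, mul_add, h0, add_zero, mul_assoc, h.corner]
  have hcf : f * c = c * f := by rw [h.f_eq, sub_mul, mul_sub, hce, mul_one, one_mul]
  rw [← sub_eq_zero]
  refine h.eq_zero_of_components (h.mul_e_eq_zero fun m hm => ?_) ?_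
    (h.f_mul_eq_zero fun m hm => ?_)
  · rw [sub_mul, mul_assoc, mul_assoc, hc _ (hm.mul_left h x), hc m hm, mul_assoc, sub_self]
  · have := hc _ (h.inCorner x)
    have hx : e * (x * c) * f = e * x * f * c := by simp only [mul_assoc, hcf]
    rw [mul_sub, sub_mul, ← mul_assoc, hce, hx, ← this]
    simp only [mul_assoc, sub_self]
  · rw [mul_sub, ← mul_assoc, ← mul_assoc, ← hc m hm, mul_assoc, hc _ (hm.mul_right h x),
      sub_self]

theorem jordanProd_e_mul_e (h : IsTriangularPair e f) (x : R) :
    jordanProd x e * e = 2 * (x * e) := by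
  simp only [jordanProd, add_mul, mul_assoc, h.idem, h.corner, two_mul]

theorem jordanProd_e_corner (h : IsTriangularPair e f) (x : R) :
    e * jordanProd x e * f = e * x * f := by
  simp only [jordanProd, add_mul, mul_add, mul_assoc, h.e_mul_f, mul_zero, zero_add]
  rw [← mul_assoc e e, h.idem]

theorem f_mul_jordanProd_e (h : IsTriangularPair e f) (x : R) : f * jordanProd x e = 0 := by
  rw [jordanProd, mul_add, h.f_mul_mul_e, ← mul_assoc, h.f_mul_e, zero_mul, add_zero]

theorem jordanProd_f_mul_e (h : IsTriangularPair e f) (x : R) : jordanProd x f * e = 0 := by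
  rw [jordanProd, add_mul, mul_assoc, mul_assoc, h.f_mul_mul_e, h.f_mul_e, mul_zero, add_zero]

theorem jordanProd_f_corner (h : IsTriangularPair e f) (x : R) :
    e * jordanProd x f * f = e * x * f := by
  simp only [jordanProd, add_mul, mul_add, mul_assoc, h.idem_f, h.f_mul_mul_f]
  rw [← mul_assoc e f x, h.e_mul_f, zero_mul, add_zero]

theorem f_mul_jordanProd_f (h : IsTriangularPair e f) (x : R) :
    f * jordanProd x f = 2 * (f * x) := by
  rw [jordanProd, mul_add, h.f_mul_mul_f, ← mul_assoc, h.idem_f, two_mul]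

theorem jordanFold_e_mul_e (h : IsTriangularPair e f) (k : ℕ) (x : R) :
    jordanFold x (List.replicate k e) * e = 2 ^ k * (x * e) := by
  induction k generalizing x with
  | zero => simp
  | succ k ih =>
    rw [List.replicate_succ, jordanFold_cons, ih, h.jordanProd_e_mul_e, pow_succ, mul_assoc]

theorem jordanFold_e_corner (h : IsTriangularPair e f) (k : ℕ) (x : R) :
    e * jordanFold x (List.replicate k e) * f = e * x * f := by
  induction k generalizing x with
  | zero => simp
  | succ k ih => rw [List.replicate_succ, jordanFold_cons, ih, h.jordanProd_e_corner]

theorem f_mul_jordanFold_e (h : IsTriangularPair e f) (k : ℕ) (x : R) :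
    f * jordanFold x (List.replicate (k + 1) e) = 0 := by
  rw [List.replicate_succ', jordanFold_append, jordanFold_cons, jordanFold_nil,
    h.f_mul_jordanProd_e]

theorem jordanFold_f_mul_e (h : IsTriangularPair e f) (k : ℕ) (x : R) :
    jordanFold x (List.replicate (k + 1) f) * e = 0 := by
  rw [List.replicate_succ', jordanFold_append, jordanFold_cons, jordanFold_nil,
    h.jordanProd_f_mul_e]

theorem jordanFold_f_corner (h : IsTriangularPair e f) (k : ℕ) (x : R) :
    e * jordanFold x (List.replicate k f) * f = e * x * f := by
  induction k generalizing x with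
  | zero => simp
  | succ k ih => rw [List.replicate_succ, jordanFold_cons, ih, h.jordanProd_f_corner]

theorem f_mul_jordanFold_f (h : IsTriangularPair e f) (k : ℕ) (x : R) :
    f * jordanFold x (List.replicate k f) = 2 ^ k * (f * x) := by
  induction k generalizing x with
  | zero => simp
  | succ k ih =>
    rw [List.replicate_succ, jordanFold_cons, ih, h.f_mul_jordanProd_f, pow_succ, mul_assoc]

/-- The entry `e` kills the `f`-component, the copies of `f` kill the `e`-component, and all of them
fix the corner. -/
theorem jordanFold_e_f (h : IsTriangularPair e f) (k : ℕ) (x : R) :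
    jordanFold x (e :: List.replicate (k + 1) f) = e * x * f := by
  rw [jordanFold_cons]
  apply h.ext_components
  · rw [h.jordanFold_f_mul_e, (h.inCorner x).mul_e h]
  · rw [h.jordanFold_f_corner, h.jordanProd_e_corner, (h.inCorner x).eq_mul_mul]
  · rw [h.f_mul_jordanFold_f, h.f_mul_jordanProd_e, mul_zero, (h.inCorner x).f_mul h]

theorem jordanProd_corner_e (h : IsTriangularPair e f) {m : R} (hm : InCorner e f m) :
    jordanProd m e = m := by
  rw [jordanProd, hm.mul_e h, hm.left, zero_add]

theorem jordanProd_corner_f (h : IsTriangularPair e f) {m : R} (hm : InCorner e f m) :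
    jordanProd m f = m := by
  rw [jordanProd, hm.f_mul h, hm.right, add_zero]

theorem jordanFold_corner_e (h : IsTriangularPair e f) {m : R} (hm : InCorner e f m) (k : ℕ) :
    jordanFold m (List.replicate k e) = m := by
  induction k with
  | zero => rfl
  | succ k ih => rw [List.replicate_succ, jordanFold_cons, h.jordanProd_corner_e hm, ih]

theorem jordanProd_inCorner (h : IsTriangularPair e f) {m : R} (hm : InCorner e f m) (x : R) :
    InCorner e f (jordanProd x m) :=
  (hm.mul_left h x).add (hm.mul_right h x)

/-- The product with `m` lands in the corner, where `e` acts as the identity. The copies of `e` are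
padding that turns long identities into binary ones. -/
theorem jordanFold_corner_cons (h : IsTriangularPair e f) {m : R} (hm : InCorner e f m) (k : ℕ)
    (x : R) : jordanFold x (m :: List.replicate k e) = jordanProd x m := by
  rw [jordanFold_cons, h.jordanFold_corner_e (h.jordanProd_inCorner hm x)]

end IsTriangularPair

theorem two_pow_mul_eq_zero {R : Type*} [Ring R] (h2 : ∀ x : R, 2 * x = 0 → x = 0) (k : ℕ) {x : R}
    (hx : 2 ^ k * x = 0) : x = 0 := by
  induction k with
  | zero => simpa using hx
  | succ k ih => exact ih (h2 _ (by rw [← mul_assoc, ← pow_succ', hx]))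

namespace IsTriangularPair

variable {R : Type*} [Ring R] {e f : R}

/-- If `w` anticommutes with the corner and its `f`-component vanishes, so does its
`e`-component. -/
theorem mul_e_eq_zero_of_anticomm (h : IsTriangularPair e f) {w : R}
    (hw : ∀ m, InCorner e f m → jordanProd w m = 0) (hf : f * w = 0) : w * e = 0 :=
  h.mul_e_eq_zero fun m hm => by
    have := hw m hm
    rwa [jordanProd, ← hm.mul_eq' w, hf, mul_zero, add_zero] at this

theorem f_mul_eq_zero_of_anticomm (h : IsTriangularPair e f) {w : R}
    (hw : ∀ m, InCorner e f m → jordanProd w m = 0) (he : w * e = 0) : f * w = 0 :=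
  h.f_mul_eq_zero fun m hm => by
    have := hw m hm
    rwa [jordanProd, ← hm.mul_eq w, he, zero_mul, zero_add] at this

end IsTriangularPair

/-! ### Centralizers are central multiplications. -/

theorem IsJordanListCentralizer.eq_center_mul {R : Type*} [Ring R] {e f : R}
    (h : IsTriangularPair e f) (h2 : ∀ x : R, 2 * x = 0 → x = 0) {k : ℕ} {θ : R → R}
    (hθ : IsJordanListCentralizer (k + 2) θ) :
    ∃ c : R, (∀ x, c * x = x * c) ∧ ∀ x, θ x = c * x := by
  have hE : ∀ x, θ (jordanFold x (List.replicate (k + 2) e)) =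
      jordanFold (θ x) (List.replicate (k + 2) e) := fun x => hθ _ _ (by simp)
  have hF : ∀ x, θ (jordanFold x (List.replicate (k + 2) f)) =
      jordanFold (θ x) (List.replicate (k + 2) f) := fun x => hθ _ _ (by simp)
  have hM : ∀ x, θ (e * x * f) = e * θ x * f := fun x => by
    rw [← h.jordanFold_e_f k, ← h.jordanFold_e_f k]
    exact hθ _ _ (by simp)
  have hJ : ∀ x m, InCorner e f m → θ (jordanProd x m) = jordanProd (θ x) m := fun x m hm => by
    rw [← h.jordanFold_corner_cons hm (k + 1), ← h.jordanFold_corner_cons hm (k + 1)]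
    exact hθ _ _ (by simp)
  have h0 : θ 0 = 0 := by
    have : InCorner e f (0 : R) := ⟨by simp, by simp⟩
    simpa [jordanProd] using hJ 0 0 this
  -- Since `e ∘ f = 0`, folding `θ e` with copies of `f` gives `θ 0 = 0`; its `f`-component is a
  -- power of 2 times `f * θ e`.
  have hfe : f * θ e = 0 := by
    have h1 : jordanFold e (List.replicate (k + 2) f) = 0 := by
      rw [List.replicate_succ, jordanFold_cons]
      simp [jordanProd, h.e_mul_f, h.f_mul_e]
    have h3 := hF e
    rw [h1, h0] at h3
    refine two_pow_mul_eq_zero h2 (k + 2) ?_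
    rw [← h.f_mul_jordanFold_f, ← h3, mul_zero]
  have hef : θ f * e = 0 := by
    have h1 : jordanFold f (List.replicate (k + 2) e) = 0 := by
      rw [List.replicate_succ, jordanFold_cons]
      simp [jordanProd, h.e_mul_f, h.f_mul_e]
    have h3 := hE f
    rw [h1, h0] at h3
    refine two_pow_mul_eq_zero h2 (k + 2) ?_
    rw [← h.jordanFold_e_mul_e, ← h3, zero_mul]
  have hce : ∀ m, InCorner e f m → θ m = θ e * m := fun m hm => by
    have := hJ e m hm
    rw [jordanProd, jordanProd, hm.left, hm.mul_e h, ← hm.mul_eq' (θ e), hfe] at this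
    simpa using this
  have hcf : ∀ m, InCorner e f m → θ m = m * θ f := fun m hm => by
    have := hJ f m hm
    rw [jordanProd, jordanProd, hm.right, hm.f_mul h, ← hm.mul_eq (θ f), hef] at this
    simpa using this
  set c : R := θ e * e + f * θ f with hc
  have hcm : ∀ m, InCorner e f m → θ m = c * m := fun m hm => by
    rw [hc, add_mul, hm.mul_eq, mul_assoc, (hm.mul_left h _).f_mul h, add_zero, hce m hm]
  have hmc : ∀ m, InCorner e f m → θ m = m * c := fun m hm => by
    rw [hc, mul_add, ← mul_assoc, (hm.mul_right h _).mul_e h, zero_add, hm.mul_eq', hcf m hm]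
  have hcen : ∀ x, c * x = x * c := by
    refine h.central_of_commute_corner ?_ fun m hm => by rw [← hcm m hm, hmc m hm]
    rw [hc, mul_add, add_mul, ← mul_assoc e f, h.e_mul_f, mul_assoc, mul_assoc, h.e_mul_f]
    simp
  refine ⟨c, hcen, fun x => ?_⟩
  have hanti : ∀ x m, InCorner e f m → jordanProd (θ x - c * x) m = 0 := fun x m hm => by
    rw [jordanProd_sub_left, ← hJ x m hm, hcm _ (h.jordanProd_inCorner hm x), jordanProd,
      jordanProd, mul_add, ← mul_assoc, ← mul_assoc, hcen m, ← mul_assoc, sub_self]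
  -- First replace `x` by its fold with copies of `e`: this kills the `f`-component of the
  -- difference, so the anticommutation criterion applies, at the cost of a power of 2.
  have he : (θ x - c * x) * e = 0 := by
    refine two_pow_mul_eq_zero h2 (k + 2) ?_
    rw [← h.jordanFold_e_mul_e, jordanFold_sub, jordanFold_center_mul hcen, ← hE]
    refine h.mul_e_eq_zero_of_anticomm (hanti _) ?_
    rw [mul_sub, hE, h.f_mul_jordanFold_e, ← mul_assoc, ← hcen f, mul_assoc,
      h.f_mul_jordanFold_e, mul_zero, sub_zero]
  rw [← sub_eq_zero]
  refine h.eq_zero_of_components he ?_ (h.f_mul_eq_zero_of_anticomm (hanti x) he)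
  rw [mul_sub, sub_mul, ← hM, hcm _ (h.inCorner x), ← mul_assoc e c x, ← hcen e]
  simp [mul_assoc]

/-! ### Jordan derivations vanishing at `e` and `f`. -/

namespace IsJordanListDerivation

variable {R : Type*} [Ring R] {e f : R} {k : ℕ} {d : R → R}

theorem map_zero (hd : IsJordanListDerivation (k + 1) d) : d 0 = 0 := by
  have := hd 0 (List.replicate (k + 1) 0) (by simp)
  rw [jordanFold_zero, jordanVariation_zero, add_zero, List.replicate_succ', jordanFold_append,
    jordanFold_cons, jordanProd_zero_right] at this
  simpa using this

theorem map_jordanFold_of_forall (hd : IsJordanListDerivation k d) (x : R) {l : List R}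
    (hl : l.length = k) (h0 : ∀ a ∈ l, d a = 0) : d (jordanFold x l) = jordanFold (d x) l := by
  rw [hd x l hl, jordanVariation_eq_zero h0, add_zero]

section Normalized

variable (h : IsTriangularPair e f) (h2 : ∀ x : R, 2 * x = 0 → x = 0)
  (hd : IsJordanListDerivation (k + 2) d) (he : d e = 0) (hf : d f = 0)

include hd he in
theorem map_jordanFold_e (x : R) : d (jordanFold x (List.replicate (k + 2) e)) =
    jordanFold (d x) (List.replicate (k + 2) e) :=
  hd.map_jordanFold_of_forall x (by simp) fun a ha => by rw [List.eq_of_mem_replicate ha, he]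

include hd hf in
theorem map_jordanFold_f (x : R) : d (jordanFold x (List.replicate (k + 2) f)) =
    jordanFold (d x) (List.replicate (k + 2) f) :=
  hd.map_jordanFold_of_forall x (by simp) fun a ha => by rw [List.eq_of_mem_replicate ha, hf]

include h hd he hf in
theorem map_corner (x : R) : d (e * x * f) = e * d x * f := by
  rw [← h.jordanFold_e_f k, ← h.jordanFold_e_f k]
  refine hd.map_jordanFold_of_forall x (by simp) fun a ha => ?_
  rcases List.mem_cons.1 ha with rfl | ha
  · exact he
  · rw [List.eq_of_mem_replicate ha, hf]

include h hd he hf in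
theorem inCorner_map {m : R} (hm : InCorner e f m) : InCorner e f (d m) := by
  rw [← hm.eq_mul_mul, hd.map_corner h he hf]
  exact h.inCorner _

include h hd he hf in
theorem map_jordanProd_corner {m : R} (hm : InCorner e f m) (x : R) :
    d (jordanProd x m) = jordanProd (d x) m + jordanProd x (d m) := by
  have h1 := hd x (m :: List.replicate (k + 1) e) (by simp)
  rw [h.jordanFold_corner_cons hm, h.jordanFold_corner_cons hm, jordanVariation,
    h.jordanFold_corner_e (h.jordanProd_inCorner (hd.inCorner_map h he hf hm) x),
    jordanVariation_eq_zero fun a ha => by rw [List.eq_of_mem_replicate ha, he], add_zero] at h1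
  exact h1

include h h2 hd he hf in
-- Folding `x` with copies of `f` leaves only its corner part, which `d` keeps in the corner; yet
-- the result has `f`-component `2 ^ (k + 2) * (f * d x)`.
theorem f_mul_map_eq_zero {x : R} (hx : f * x = 0) : f * d x = 0 := by
  have h1 : jordanFold x (List.replicate (k + 2) f) = e * x * f := by
    apply h.ext_components
    · rw [h.jordanFold_f_mul_e, (h.inCorner x).mul_e h]
    · rw [h.jordanFold_f_corner, (h.inCorner x).eq_mul_mul]
    · rw [h.f_mul_jordanFold_f, hx, mul_zero, (h.inCorner x).f_mul h]
  refine two_pow_mul_eq_zero h2 (k + 2) ?_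
  rw [← h.f_mul_jordanFold_f, ← hd.map_jordanFold_f hf, h1]
  exact (hd.inCorner_map h he hf (h.inCorner x)).f_mul h

include h h2 hd he hf in
theorem map_mul_e_eq_zero {x : R} (hx : x * e = 0) : d x * e = 0 := by
  have h1 : jordanFold x (List.replicate (k + 2) e) = e * x * f := by
    apply h.ext_components
    · rw [h.jordanFold_e_mul_e, hx, mul_zero, (h.inCorner x).mul_e h]
    · rw [h.jordanFold_e_corner, (h.inCorner x).eq_mul_mul]
    · rw [h.f_mul_jordanFold_e, (h.inCorner x).f_mul h]
  refine two_pow_mul_eq_zero h2 (k + 2) ?_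
  rw [← h.jordanFold_e_mul_e, ← hd.map_jordanFold_e he, h1]
  exact (hd.inCorner_map h he hf (h.inCorner x)).mul_e h

include h h2 hd he hf in
-- Since `(e + m) ∘ u = u` for `u` in the corner, the Leibniz rule makes `d (e + m)` anticommute
-- with the corner.
theorem map_e_add_corner {m : R} (hm : InCorner e f m) : d (e + m) = d m := by
  have hfp : f * d (e + m) = 0 :=
    hd.f_mul_map_eq_zero h h2 he hf (by rw [mul_add, h.f_mul_e, hm.f_mul h, add_zero])
  have key : ∀ u, InCorner e f u → jordanProd (e + m) u = u := fun u hu => by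
    have h1 : m * u = 0 := by rw [← hu.left, ← mul_assoc, hm.mul_e h, zero_mul]
    have h3 : u * m = 0 := by rw [← hm.left, ← mul_assoc, hu.mul_e h, zero_mul]
    rw [jordanProd, add_mul, mul_add, hu.left, hu.mul_e h, h1, h3]
    simp
  apply h.ext_components
  · rw [(hd.inCorner_map h he hf hm).mul_e h]
    refine h.mul_e_eq_zero_of_anticomm (fun u hu => ?_) hfp
    have := hd.map_jordanProd_corner h he hf hu (e + m)
    rwa [key u hu, key _ (hd.inCorner_map h he hf hu), right_eq_add] at this
  · rw [← hd.map_corner h he hf, mul_add, add_mul, h.idem, h.e_mul_f, zero_add, hm.eq_mul_mul,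
      (hd.inCorner_map h he hf hm).eq_mul_mul]
  · rw [hfp, (hd.inCorner_map h he hf hm).f_mul h]

include h h2 hd he hf in
theorem map_f_add_corner {m : R} (hm : InCorner e f m) : d (f + m) = d m := by
  have hpe : d (f + m) * e = 0 :=
    hd.map_mul_e_eq_zero h h2 he hf (by rw [add_mul, h.f_mul_e, hm.mul_e h, add_zero])
  have key : ∀ u, InCorner e f u → jordanProd (f + m) u = u := fun u hu => by
    have h1 : m * u = 0 := by rw [← hu.left, ← mul_assoc, hm.mul_e h, zero_mul]
    have h3 : u * m = 0 := by rw [← hm.left, ← mul_assoc, hu.mul_e h, zero_mul]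
    rw [jordanProd, add_mul, mul_add, hu.right, hu.f_mul h, h1, h3]
    simp
  apply h.ext_components
  · rw [hpe, (hd.inCorner_map h he hf hm).mul_e h]
  · rw [← hd.map_corner h he hf, mul_add, add_mul, h.e_mul_f, zero_mul, zero_add, hm.eq_mul_mul,
      (hd.inCorner_map h he hf hm).eq_mul_mul]
  · rw [(hd.inCorner_map h he hf hm).f_mul h]
    refine h.f_mul_eq_zero_of_anticomm (fun u hu => ?_) hpe
    have := hd.map_jordanProd_corner h he hf hu (f + m)
    rwa [key u hu, key _ (hd.inCorner_map h he hf hu), right_eq_add] at this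

include h h2 hd he hf in
-- Additivity comes from writing the sum as a product: `m + m' = (e + m) ∘ (f + m')`.
theorem map_add_corner {m m' : R} (hm : InCorner e f m) (hm' : InCorner e f m') :
    d (m + m') = d m + d m' := by
  have key : ∀ u v, InCorner e f u → InCorner e f v → u * v = 0 := fun u v hu hv => by
    rw [← hv.left, ← mul_assoc, hu.mul_e h, zero_mul]
  have hdm := hd.inCorner_map h he hf hm
  have hdm' := hd.inCorner_map h he hf hm'
  have h1 := hd (e + m) ((f + m') :: List.replicate (k + 1) e) (by simp)
  have e1 : jordanProd (e + m) (f + m') = m + m' := by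
    simp only [jordanProd, add_mul, mul_add, h.e_mul_f, h.f_mul_e, hm.right, hm.f_mul h, hm'.left,
      hm'.mul_e h, key _ _ hm hm', key _ _ hm' hm]
    abel
  have e2 : jordanProd (d m) (f + m') = d m := by
    simp only [jordanProd, add_mul, mul_add, hdm.right, hdm.f_mul h, key _ _ hdm hm',
      key _ _ hm' hdm, add_zero]
  have e3 : jordanProd (e + m) (d m') = d m' := by
    simp only [jordanProd, add_mul, mul_add, hdm'.left, hdm'.mul_e h, key _ _ hdm' hm,
      key _ _ hm hdm', add_zero]
  rw [jordanVariation, hd.map_e_add_corner h h2 he hf hm, hd.map_f_add_corner h h2 he hf hm',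
    jordanFold_cons, jordanFold_cons, e1, e2, e3, h.jordanFold_corner_e (hm.add hm'),
    h.jordanFold_corner_e hdm, h.jordanFold_corner_e hdm',
    jordanVariation_eq_zero fun a ha => by rw [List.eq_of_mem_replicate ha, he], add_zero] at h1
  exact h1

include h h2 hd he hf in
-- Additivity on the corner, applied to `x ∘ m` and `y ∘ m`, makes the additivity defect anticommute
-- with the corner.
theorem map_add (x y : R) : d (x + y) = d x + d y := by
  have hanti : ∀ x y m, InCorner e f m → jordanProd (d (x + y) - (d x + d y)) m = 0 := by
    intro x y m hm
    have h1 := hd.map_add_corner h h2 he hf (h.jordanProd_inCorner hm x)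
      (h.jordanProd_inCorner hm y)
    rw [← jordanProd_add_left, hd.map_jordanProd_corner h he hf hm,
      hd.map_jordanProd_corner h he hf hm, hd.map_jordanProd_corner h he hf hm,
      jordanProd_add_left x y] at h1
    rw [jordanProd_sub_left, jordanProd_add_left, sub_eq_zero]
    have h3 : ∀ a b c p q : R, a + (p + q) = b + p + (c + q) → a = b + c := by
      intro a b c p q H
      have : a + (p + q) = b + c + (p + q) := by rw [H]; abel
      exact add_right_cancel this
    exact h3 _ _ _ _ _ h1
  have hwe : (d (x + y) - (d x + d y)) * e = 0 := by
    refine two_pow_mul_eq_zero h2 (k + 2) ?_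
    rw [← h.jordanFold_e_mul_e, jordanFold_sub, jordanFold_add, ← hd.map_jordanFold_e he,
      ← hd.map_jordanFold_e he, ← hd.map_jordanFold_e he, jordanFold_add]
    refine h.mul_e_eq_zero_of_anticomm (hanti _ _) ?_
    rw [← jordanFold_add, mul_sub, mul_add]
    simp only [hd.map_jordanFold_e he, h.f_mul_jordanFold_e, add_zero, sub_zero]
  rw [← sub_eq_zero]
  refine h.eq_zero_of_components hwe ?_ (h.f_mul_eq_zero_of_anticomm (hanti x y) hwe)
  have h1 := hd.map_add_corner h h2 he hf (h.inCorner x) (h.inCorner y)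
  rw [← add_mul, ← mul_add] at h1
  simp only [hd.map_corner h he hf] at h1
  rw [mul_sub, sub_mul, h1, mul_add, add_mul, sub_self]

include h h2 hd he hf in
theorem map_sub (x y : R) : d (x - y) = d x - d y := by
  rw [eq_sub_iff_add_eq, ← hd.map_add h h2 he hf, sub_add_cancel]

include h h2 hd he hf in
theorem map_mul_corner {m : R} (hm : InCorner e f m) (x : R) : d (x * m) = d x * m + x * d m := by
  have hdm := hd.inCorner_map h he hf hm
  -- With `x * e` in place of `x` the term `m * (x * e)` vanishes, so the Jordan product reduces to
  -- `x * m`.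
  have h1 := hd.map_jordanProd_corner h he hf hm (x * e)
  have h3 : f * d (x * e) = 0 := hd.f_mul_map_eq_zero h h2 he hf (h.f_mul_mul_e x)
  have h4 : d x * e = d (x * e) * e := by
    have := hd.map_mul_e_eq_zero h h2 he hf (x := x - x * e)
      (by rw [sub_mul, mul_assoc, h.idem, sub_self])
    rwa [hd.map_sub h h2 he hf, sub_mul, sub_eq_zero] at this
  rw [jordanProd, jordanProd, jordanProd, hm.mul_eq, hdm.mul_eq, ← hm.mul_eq' (d (x * e)), h3,
    ← hm.mul_eq (d (x * e)), ← h4, hm.mul_eq, ← mul_assoc, ← mul_assoc,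
    (hm.mul_right h x).mul_e h, (hdm.mul_right h x).mul_e h] at h1
  simpa using h1

include h h2 hd he hf in
theorem map_corner_mul {m : R} (hm : InCorner e f m) (x : R) : d (m * x) = d m * x + m * d x := by
  have h1 := hd.map_jordanProd_corner h he hf hm x
  have h3 := hd.map_add_corner h h2 he hf (hm.mul_left h x) (hm.mul_right h x)
  rw [jordanProd, h3, hd.map_mul_corner h h2 he hf hm] at h1
  have h4 : d x * m + x * d m + d (m * x) =
      d x * m + x * d m + (d m * x + m * d x) := by
    rw [h1, jordanProd, jordanProd]; abel
  exact add_left_cancel h4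

include h h2 hd he hf in
/-- A Jordan derivation vanishing at the two diagonal idempotents is a derivation. -/
theorem isRingDerivation_of_normalized : IsRingDerivation d where
  map_add := hd.map_add h h2 he hf
  map_mul := by
    intro x y
    rw [← sub_eq_zero]
    have split : ∀ u v : R, e * (u * v) * f = u * (e * v * f) + e * u * f * v := fun u v => by
      have : e * (u * v) * f = e * (u * ((e + f) * v)) * f := by rw [h.add_eq_one, one_mul]
      rw [this]
      simp only [add_mul, mul_add, mul_assoc, h.f_mul_mul_f]
      rw [← mul_assoc u e, ← mul_assoc e (u * e), h.corner, mul_assoc]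
    -- The diagonal components are tested on the corner by expanding `d (x * y * m)` and `d (m * x *
    -- y)` in two ways; the corner component follows from `split`.
    refine h.eq_zero_of_components (h.mul_e_eq_zero fun m hm => ?_) ?_
      (h.f_mul_eq_zero fun m hm => ?_)
    · have h1 := hd.map_mul_corner h h2 he hf hm (x * y)
      rw [mul_assoc x y m, hd.map_mul_corner h h2 he hf (hm.mul_left h y),
        hd.map_mul_corner h h2 he hf hm] at h1
      rw [sub_mul, eq_sub_of_add_eq h1.symm]
      noncomm_ring
    · have h1 := hd.map_add h h2 he hf (x * (e * y * f)) (e * x * f * y)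
      rw [← split, hd.map_corner h he hf, hd.map_mul_corner h h2 he hf (h.inCorner y),
        hd.map_corner_mul h h2 he hf (h.inCorner x), hd.map_corner h he hf,
        hd.map_corner h he hf] at h1
      rw [mul_sub, sub_mul, h1, mul_add, add_mul, split, split]
      abel
    · have h1 := hd.map_corner_mul h h2 he hf hm (x * y)
      rw [← mul_assoc, hd.map_corner_mul h h2 he hf (hm.mul_right h x),
        hd.map_corner_mul h h2 he hf hm] at h1
      rw [mul_sub, eq_sub_of_add_eq' h1.symm]
      noncomm_ring

end Normalized

end IsJordanListDerivation

/-! ### Values at the idempotents and reduction to the normalized case. -/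

namespace IsJordanListDerivation

variable {R : Type*} [Ring R] {e f : R} {k : ℕ} {d : R → R}

section DiagonalValues

variable (h : IsTriangularPair e f) (h2 : ∀ x : R, 2 * x = 0 → x = 0)
  (hd : IsJordanListDerivation (k + 2) d)

include h h2 hd in
/-- The values at the orthogonal idempotents `e` and `f` are tied by `e ∘ f = 0`. -/
theorem jordanProd_map_e_add_map_f : jordanProd (d e) f + jordanProd e (d f) = 0 := by
  have hef : jordanProd e f = 0 := by rw [jordanProd, h.e_mul_f, h.f_mul_e, add_zero]
  have key : ∀ l : List R, l.length = k + 1 →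
      jordanFold (jordanProd (d e) f + jordanProd e (d f)) l = 0 := fun l hl => by
    have h1 := hd e (f :: l) (by simp [hl])
    rw [jordanFold_cons, jordanFold_cons, jordanVariation, hef, jordanFold_zero,
      jordanVariation_zero, hd.map_zero, add_zero, ← jordanFold_add] at h1
    exact h1.symm
  have kE := key (List.replicate (k + 1) e) (by simp)
  have kF := key (List.replicate (k + 1) f) (by simp)
  refine h.eq_zero_of_components (two_pow_mul_eq_zero h2 (k + 1) ?_) ?_
    (two_pow_mul_eq_zero h2 (k + 1) ?_)
  · rw [← h.jordanFold_e_mul_e, kE, zero_mul]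
  · rw [← h.jordanFold_e_corner (k + 1), kE, mul_zero, zero_mul]
  · rw [← h.f_mul_jordanFold_f, kF, mul_zero]

include h h2 hd in
theorem f_mul_map_e : f * d e = 0 := by
  have h1 := congrArg (f * ·) (hd.jordanProd_map_e_add_map_f h h2)
  simp only [mul_add, mul_zero, jordanProd_comm e, h.f_mul_jordanProd_f, h.f_mul_jordanProd_e,
    add_zero] at h1
  exact h2 _ h1

include h h2 hd in
theorem map_f_mul_e : d f * e = 0 := by
  have h1 := congrArg (· * e) (hd.jordanProd_map_e_add_map_f h h2)
  simp only [add_mul, zero_mul, jordanProd_comm e, h.jordanProd_f_mul_e, h.jordanProd_e_mul_e,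
    zero_add] at h1
  exact h2 _ h1

include h h2 hd in
theorem corner_map_e_add_corner_map_f : e * d e * f + e * d f * f = 0 := by
  have h1 := congrArg (e * · * f) (hd.jordanProd_map_e_add_map_f h h2)
  simpa only [mul_add, add_mul, mul_zero, zero_mul, jordanProd_comm e, h.jordanProd_f_corner,
    h.jordanProd_e_corner] using h1

include h h2 hd in
theorem jordanProd_corner_map_e {m : R} (hm : InCorner e f m) : jordanProd m (d e) = d e * m := by
  rw [jordanProd, ← hm.mul_eq' (d e), hd.f_mul_map_e h h2, mul_zero, zero_add]

include h h2 hd in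
theorem jordanProd_corner_map_f {m : R} (hm : InCorner e f m) : jordanProd m (d f) = m * d f := by
  rw [jordanProd, ← hm.mul_eq (d f), hd.map_f_mul_e h h2, zero_mul, add_zero]

include h h2 hd in
theorem jordanVariation_corner_e {m : R} (hm : InCorner e f m) (j : ℕ) :
    jordanVariation d m (List.replicate j e) = (j : R) * (d e * m) := by
  induction j with
  | zero => simp [jordanVariation]
  | succ j ih =>
    rw [List.replicate_succ, jordanVariation, h.jordanProd_corner_e hm, ih,
      hd.jordanProd_corner_map_e h h2 hm, h.jordanFold_corner_e (hm.mul_left h _), Nat.cast_succ,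
      add_mul, one_mul, add_comm]

include h h2 hd in
-- Folding `m` with `k + 2` copies of `e` returns `m`, and folding `d m` preserves its corner part;
-- hence the total variation has zero corner part.
theorem natCast_mul_map_e_mul_corner {m : R} (hm : InCorner e f m) :
    ((k + 2 : ℕ) : R) * (d e * m) = 0 := by
  have h1 := hd m (List.replicate (k + 2) e) (by simp)
  rw [h.jordanFold_corner_e hm, hd.jordanVariation_corner_e h h2 hm] at h1
  have h3 := congrArg (e * · * f) h1
  simp only [mul_add, add_mul, h.jordanFold_e_corner] at h3
  rw [left_eq_add, ((hm.mul_left h _).mul_left h _).eq_mul_mul] at h3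
  exact h3

include h h2 hd in
-- Replacing one of the `k + 2` copies of `e` by `f` replaces one summand `d e * m` by `m * d f`;
-- both totals vanish.
theorem map_e_mul_corner_eq {m : R} (hm : InCorner e f m) : d e * m = m * d f := by
  have h1 := hd m (f :: List.replicate (k + 1) e) (by simp)
  rw [jordanVariation, jordanFold_cons, jordanFold_cons, h.jordanProd_corner_f hm,
    h.jordanFold_corner_e hm, hd.jordanVariation_corner_e h h2 hm,
    hd.jordanProd_corner_map_f h h2 hm, h.jordanFold_corner_e (hm.mul_right h _)] at h1
  have h3 := congrArg (e * · * f) h1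
  simp only [mul_add, add_mul, h.jordanFold_e_corner, h.jordanProd_f_corner] at h3
  rw [left_eq_add, (hm.mul_right h _).eq_mul_mul,
    ((hm.mul_left h _).mul_left h _).eq_mul_mul] at h3
  have h4 := hd.natCast_mul_map_e_mul_corner h h2 hm
  rw [Nat.cast_succ (k + 1), add_mul, one_mul, add_comm] at h4
  exact add_right_cancel (h4.trans h3.symm)

end DiagonalValues

/-- In a `2`-torsion free triangular ring, a multiplicative Jordan derivation is the sum of the
multiplication by a central element and a derivation. -/
theorem exists_center_mul_add (h : IsTriangularPair e f) (h2 : ∀ x : R, 2 * x = 0 → x = 0)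
    (hd : IsJordanListDerivation (k + 2) d) :
    ∃ c : R, (∀ x, c * x = x * c) ∧ ∃ δ : R → R, IsRingDerivation δ ∧ ∀ x, d x = c * x + δ x := by
  -- The commutator `e * u - u * e` equals `u`, so subtracting it removes the corner part of `d e`;
  -- that of `d f` then vanishes too, the two being opposite.
  set u : R := e * d e * f with hu
  have hu' : InCorner e f u := h.inCorner _
  set g : R → R := fun x => d x - (x * u - u * x) with hg
  have hgd : IsJordanListDerivation (k + 2) g := hd.sub (isJordanListDerivation_commutator _ u)
  have hge : e * g e * f = 0 := by
    simp only [hg]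
    rw [hu'.left, hu'.mul_e h, sub_zero, mul_sub, sub_mul, hu'.eq_mul_mul, ← hu, sub_self]
  have hgf : e * g f * f = 0 := by
    have := hgd.corner_map_e_add_corner_map_f h h2
    rwa [hge, zero_add] at this
  have hfe := hgd.f_mul_map_e h h2
  have hef := hgd.map_f_mul_e h h2
  -- Chosen so that `c * e = g e` and `c * f = g f`: subtracting multiplication by `c` normalizes
  -- `g`.
  set c : R := g e + g f with hc
  have hcm : ∀ m, InCorner e f m → c * m = g e * m := fun m hm => by
    rw [hc, add_mul, ← hm.mul_eq (g f), hef, zero_mul, add_zero]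
  have hmc : ∀ m, InCorner e f m → m * c = m * g f := fun m hm => by
    rw [hc, mul_add, ← hm.mul_eq' (g e), hfe, mul_zero, zero_add]
  have hc0 : e * c * f = 0 := by rw [hc, mul_add, add_mul, hge, hgf, add_zero]
  have hcen : ∀ x, c * x = x * c := h.central_of_commute_corner hc0 fun m hm => by
    rw [hcm m hm, hmc m hm, hgd.map_e_mul_corner_eq h h2 hm]
  have hN : ((k + 2 : ℕ) : R) * c = 0 := by
    have hNc : ∀ x, (((k + 2 : ℕ) : R) * c) * x = x * (((k + 2 : ℕ) : R) * c) := fun x => by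
      rw [mul_assoc, hcen, ← mul_assoc, ← mul_assoc, Nat.cast_comm]
    have hNm : ∀ m, InCorner e f m → (((k + 2 : ℕ) : R) * c) * m = 0 := fun m hm => by
      rw [mul_assoc, hcm m hm, hgd.natCast_mul_map_e_mul_corner h h2 hm]
    refine h.eq_zero_of_components (h.mul_e_eq_zero hNm) ?_
      (h.f_mul_eq_zero fun m hm => by rw [← hNc, hNm m hm])
    rw [← hNc, mul_assoc, h.e_mul_f, mul_zero]
  have hD : IsJordanListDerivation (k + 2) (fun x => g x - c * x) :=
    hgd.sub (isJordanListDerivation_center_mul hcen hN)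
  have hDe : g e - c * e = 0 := by
    have : g e = g e * e := by
      nth_rewrite 1 [h.eq_components (g e)]
      rw [hge, hfe, add_zero, add_zero]
    rw [hc, add_mul, hef, add_zero, ← this, sub_self]
  have hDf : g f - c * f = 0 := by
    have : g f = f * g f := by
      nth_rewrite 1 [h.eq_components (g f)]
      rw [hgf, hef, zero_add, zero_add]
    rw [hcen, hc, mul_add, hfe, zero_add, ← this, sub_self]
  have hder := hD.isRingDerivation_of_normalized h h2 hDe hDf
  refine ⟨c, hcen, fun x => (g x - c * x) + (x * u - u * x), ⟨fun s t => ?_, fun s t => ?_⟩,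
    fun x => ?_⟩
  · rw [hder.map_add]; noncomm_ring
  · rw [hder.map_mul]; noncomm_ring
  · simp only [hg]; abel

end IsJordanListDerivation

/-! ### Combining the two parts of `Δ`. -/

/-- In a `2`-torsion free triangular ring, a multiplicative generalized Jordan derivation is the sum
of the multiplication by a central element and a derivation. -/
theorem IsMulGenJordanDerivation.exists_center_mul_add {R : Type*} [Ring R] {e f : R}
    (h : IsTriangularPair e f) (h2 : ∀ x : R, 2 * x = 0 → x = 0) {n : ℕ} [NeZero n] (hn : 2 ≤ n)
    {Δ : R → R} (hΔ : IsMulGenJordanDerivation n Δ) :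
    ∃ c : R, (∀ x, c * x = x * c) ∧ ∃ δ : R → R, IsRingDerivation δ ∧ ∀ x, Δ x = c * x + δ x := by
  obtain ⟨j, rfl⟩ := Nat.exists_eq_add_of_le' hn
  obtain ⟨d, hd, hΔd⟩ := hΔ
  have hN : (j + 1) + (j + 1) = 2 * j + 2 := by ring
  have hθ := (isJordanListCentralizer_sub (N := j + 1) hd hΔd).two_mul
  have hd' := (IsMulJordanDerivation.isJordanListDerivation (N := j + 1) hd).two_mul
  rw [hN] at hθ hd'
  obtain ⟨c, hc, hθc⟩ := hθ.eq_center_mul h h2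
  obtain ⟨c', hc', δ, hδ, hdδ⟩ := hd'.exists_center_mul_add h h2
  refine ⟨c + c', fun x => by rw [add_mul, mul_add, hc, hc'], δ, hδ, fun x => ?_⟩
  rw [add_mul, add_assoc, ← hdδ, ← hθc, sub_add_cancel]

/-! ### Upper triangular matrices as a triangular ring. -/

section UpperTriangular

variable {A : Type*} [Ring A] {s : ℕ}

/-- The matrix with the single nonzero entry `a` at `(i, j)`, for `i ≤ j`, as an upper triangular
matrix. -/
def upperSingle {i j : Fin s} (hij : i ≤ j) (a : A) : upperTriangularRing s A :=
  ⟨Matrix.single i j a, Matrix.blockTriangular_single hij a⟩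

theorem upperTriangularRing.apply_eq_zero (x : upperTriangularRing s A) {i j : Fin s}
    (hij : j < i) : (x : Matrix (Fin s) (Fin s) A) i j = 0 :=
  x.2 hij

theorem coe_upperSingle {i j : Fin s} (hij : i ≤ j) (a : A) :
    (upperSingle hij a : Matrix (Fin s) (Fin s) A) = Matrix.single i j a := rfl

theorem isTriangularPair_upperSingle :
    IsTriangularPair (upperSingle (le_refl (0 : Fin (s + 2))) (1 : A))
      (1 - upperSingle (le_refl (0 : Fin (s + 2))) (1 : A)) where
  idem := by
    apply Subtype.ext
    simp [coe_upperSingle, Subring.coe_mul]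
  add_eq_one := by abel
  corner x := by
    apply Subtype.ext
    ext i j
    simp only [coe_upperSingle, Subring.coe_mul]
    rcases eq_or_ne i 0 with rfl | hi
    · simp
    · rw [Matrix.single_mul_apply_of_ne _ _ _ _ _ hi]
      rcases eq_or_ne j 0 with rfl | hj
      · simp [upperTriangularRing.apply_eq_zero x (Fin.pos_of_ne_zero hi)]
      · rw [Matrix.mul_single_apply_of_ne _ _ _ _ _ hj]
  faithful_left a ha := by
    -- Right multiplication by the matrix unit at `(0, 1)` moves column 0 of `a` to column 1.
    have h1 := congrArg Subtype.val (ha (upperSingle (Fin.zero_le 1) 1))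
    apply Subtype.ext
    ext i j
    have h3 := congrFun (congrFun h1 i) 1
    simp only [coe_upperSingle, Subring.coe_mul, AddSubgroupClass.coe_sub, Subring.coe_zero,
      mul_sub, mul_one] at h3 ⊢
    rcases eq_or_ne j 0 with rfl | hj
    · simpa using h3
    · rw [Matrix.mul_single_apply_of_ne _ _ _ _ _ hj]; rfl
  faithful_right b hb := by
    apply Subtype.ext
    ext i j
    simp only [coe_upperSingle, Subring.coe_mul, AddSubgroupClass.coe_sub, Subring.coe_zero,
      sub_mul, one_mul]
    rcases eq_or_ne i 0 with rfl | hi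
    · simp
    -- Left multiplication by the matrix unit at `(0, i)` moves row `i` of `b` to row 0.
    · have h1 := congrArg Subtype.val (hb (upperSingle (Fin.zero_le i) 1))
      have h3 := congrFun (congrFun h1 0) j
      simp only [coe_upperSingle, Subring.coe_mul, AddSubgroupClass.coe_sub, Subring.coe_zero,
        mul_sub, mul_one] at h3
      rw [Matrix.sub_apply, Matrix.single_mul_apply_of_ne _ _ _ _ _ hi]
      simpa [hi] using h3

/-- Central elements of the ring of upper triangular matrices are central scalar matrices. -/
theorem exists_center_smul_of_central {c : upperTriangularRing (s + 1) A}
    (hc : ∀ x, c * x = x * c) :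
    ∃ μ ∈ Subring.center A, ∀ x : upperTriangularRing (s + 1) A,
      ((c * x : upperTriangularRing (s + 1) A) : Matrix (Fin (s + 1)) (Fin (s + 1)) A) =
        μ • (x : Matrix (Fin (s + 1)) (Fin (s + 1)) A) := by
  -- Commuting with the units at `(j, j)` makes `c` diagonal, those at `(0, j)` make the diagonal
  -- constant, and `a` placed at `(0, 0)` makes that constant central.
  have key : ∀ (i j : Fin (s + 1)) (hij : i ≤ j) (a : A) (p q : Fin (s + 1)),
      ((c : Matrix (Fin (s + 1)) (Fin (s + 1)) A) * Matrix.single i j a) p q =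
        (Matrix.single i j a * (c : Matrix (Fin (s + 1)) (Fin (s + 1)) A)) p q := by
    intro i j hij a p q
    exact congrFun (congrFun (congrArg Subtype.val (hc (upperSingle hij a))) p) q
  have hoff : ∀ i j, i ≠ j → (c : Matrix (Fin (s + 1)) (Fin (s + 1)) A) i j = 0 := by
    intro i j hij
    have := key j j le_rfl 1 i j
    rw [Matrix.single_mul_apply_of_ne _ _ _ _ _ hij] at this
    simpa using this
  have hdiag : ∀ j, (c : Matrix (Fin (s + 1)) (Fin (s + 1)) A) j j =
      (c : Matrix (Fin (s + 1)) (Fin (s + 1)) A) 0 0 := by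
    intro j
    have := key 0 j (Fin.zero_le j) 1 0 j
    simpa using this.symm
  refine ⟨(c : Matrix (Fin (s + 1)) (Fin (s + 1)) A) 0 0, Subring.mem_center_iff.2 fun a => ?_,
    fun x => ?_⟩
  · simpa using (key 0 0 le_rfl a 0 0).symm
  · ext i j
    rw [Subring.coe_mul, Matrix.mul_apply, Finset.sum_eq_single i
      (fun b _ hb => by rw [hoff i b hb.symm, zero_mul]) (by simp), hdiag]
    rfl

end UpperTriangular

theorem corollary4p2 {A : Type*} [Ring A] (h2 : ∀ a : A, 2 * a = 0 → a = 0)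
    (r : ℕ) (hr : 2 ≤ r) (n : ℕ) [NeZero n] (hn : 2 ≤ n)
    (Δ : upperTriangularRing r A → upperTriangularRing r A)
    (hΔ : IsMulGenJordanDerivation n Δ) :
    ∃ μ ∈ Subring.center A, ∃ δ : upperTriangularRing r A → upperTriangularRing r A,
      IsRingDerivation δ ∧
        ∀ t : upperTriangularRing r A,
          (Δ t : Matrix (Fin r) (Fin r) A) =
            μ • (t : Matrix (Fin r) (Fin r) A) + (δ t : Matrix (Fin r) (Fin r) A) := by
  obtain ⟨s, rfl⟩ := Nat.exists_eq_add_of_le' hr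
  have h2' : ∀ x : upperTriangularRing (s + 2) A, 2 * x = 0 → x = 0 := by
    intro x hx
    apply Subtype.ext
    ext i j
    have h1 := congrFun (congrFun (congrArg Subtype.val hx) i) j
    refine h2 _ ?_
    rw [two_mul] at h1 ⊢
    exact h1
  obtain ⟨c, hc, δ, hδ, hΔδ⟩ := hΔ.exists_center_mul_add isTriangularPair_upperSingle h2' hn
  obtain ⟨μ, hμ, hcμ⟩ := exists_center_smul_of_central hc
  refine ⟨μ, hμ, δ, hδ, fun t => ?_⟩
  rw [hΔδ, Subring.coe_add, hcμ]
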